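/- Let $M$ be a finite matroid with characteristic polynomial $\chi_M(t)=t^m-a_1t^{m-1}+\cdots+(-1)^m a_m$, and let $N$ be a weak map image of $M$ with characteristic polynomial $\chi_N(t)=t^n-b_1t^{n-1}+\cdots+(-1)^n b_n$ (the ranks $m$ of $M$ and $n$ of $N$ need not be equal). Set $a_0=b_0=1$, $a_i=0$ for $i>m$ and $b_i=0$ for $i>n$. Then $$b_i\le a_i\qquad\text{for all } i\ge 0.$$ Here the characteristic polynomial of a finite matroid $M$ is $\chi_M(t)=\sum_F \mu(\hat 0,F)\,t^{\operatorname{rk}(M)-\operatorname{rk}(F)}$, where $F$ ranges over the flats of $M$ and $\mu$ is the Möbius function of the lattice of flats, whose least element $\hat 0$ is the set of loops. A weak map from $M$ to $N$ is a function $\varphi\colon E(M)\to E(N)\cup\{o\}$, where $o\notin E(N)$ is regarded as an extra loop, such that every $X\subseteq E(M)$ on which $\varphi$ is injective and for which $\varphi(X)$ is an independent set of $N$ is independent in $M$. The matroid $N$ is a weak map image of $M$ if there is a weak map from $M$ to $N$ whose image contains $E(N)$. (This includes the case of a bijection $E(M)\to E(N)$ under which the preimage of every independent set of $N$ is independent in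 $M$.) -/

import Mathlib

namespace Matroid

/-- The flats of a matroid, ordered by inclusion. For a finite matroid this is its (geometric)
lattice of flats. -/
abbrev Flats {α : Type*} (M : Matroid α) : Type _ := {F : Set α // M.IsFlat F}

/-- The smallest flat: the closure of the empty set, that is, the set of loops. -/
def botFlat {α : Type*} (M : Matroid α) : M.Flats := ⟨M.closure ∅, isFlat_closure ∅⟩

instance finite_flats {α : Type*} (M : Matroid α) [M.Finite] : Finite M.Flats :=
  Set.Finite.subset M.ground_finite.finite_subsets fun _ hF => hF.subset_ground

noncomputable instance fintypeFlats {α : Type*} (M : Matroid α) [M.Finite] : Fintype M.Flats :=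
  Fintype.ofFinite _

open Classical in
noncomputable instance locallyFiniteOrderFlats {α : Type*} (M : Matroid α) [M.Finite] :
    LocallyFiniteOrder M.Flats :=
  Fintype.toLocallyFiniteOrder

open Classical in
/-- The Möbius value `μ(0̂, F)` in the lattice of flats of a finite matroid. -/
noncomputable def moebius {α : Type*} (M : Matroid α) [M.Finite] (F : M.Flats) : ℤ :=
  IncidenceAlgebra.mu ℤ M.botFlat F

/-- The characteristic polynomial of a finite matroid,
`χ_M(t) = ∑_F μ(0̂, F) t ^ (rk(M) - rk(F))`, the sum being over the flats `F` of `M`. -/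
noncomputable def charPoly {α : Type*} (M : Matroid α) [M.Finite] : Polynomial ℤ :=
  ∑ F : M.Flats,
    Polynomial.C (M.moebius F) * Polynomial.X ^ (M.eRank.toNat - (M.eRk (F : Set α)).toNat)

/-- `φ` is a weak map from `M` to `N`. The value `none` plays the role of a loop `o` adjoined to
`N`. The condition is that if `φ` is injective on `X ⊆ E(M)` and its image `φ(X)` is an independent
set of `N`, then `X` is independent in `M`. -/
structure IsWeakMap {α β : Type*} (M : Matroid α) (N : Matroid β) (φ : α → Option β) : Prop where
  mapsTo : ∀ x ∈ M.E, ∀ y, φ x = some y → y ∈ N.E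
  indep_of_indep : ∀ X ⊆ M.E, ∀ I, N.Indep I → Set.BijOn φ X (some '' I) → M.Indep X

/-- `N` is a weak map image of `M`: some weak map from `M` to `N` reaches every element of `N`.
(Bijections `E(M) → E(N)` under which preimages of independent sets are independent are a
special case.) -/
def IsWeakMapImage {α β : Type*} (N : Matroid β) (M : Matroid α) : Prop :=
  ∃ φ : α → Option β, IsWeakMap M N φ ∧ ∀ y ∈ N.E, ∃ x ∈ M.E, φ x = some y

end Matroid

/-! By Whitney's theorem (`charPoly_eq_sum_nbcCard`), the unsigned coefficients count, by size, the
sets of nonloops containing no broken circuit, for any injective ordering of the ground set. `IsNBC`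
expresses this through closures: no nonloop `e` is spanned by the members of the set that come after
`e`.

Since the ordering is free, it can be adapted to the weak map. A section `s` of the weak map carries
independent sets of `N` to independent sets of `M`. Order `M` so that the images of the nonloops of
`N` come first, in their order in `N`. Then `s` sends broken-circuit-free sets injectively to
broken-circuit-free sets of the same size (`IsNBC.image_of_isWeakMap`), which gives the inequality.
-/

namespace Matroid

open Polynomial

/-! ### Whitney's broken circuit theorem -/

section NBC

variable {α : Type*}

/-- With respect to the order on the ground set given by `r`, the set `S` consists of nonloops and
contains no broken circuit (a circuit with at least two elements, minus its least element). -/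
structure IsNBC (M : Matroid α) (r : α → ℕ) (S : Set α) : Prop where
  subset_ground : S ⊆ M.E
  notMem_closure_empty : ∀ e ∈ S, e ∉ M.closure ∅
  notMem_closure : ∀ e, e ∉ M.closure ∅ → e ∉ M.closure {x ∈ S | r e < r x}

variable {M : Matroid α} {r : α → ℕ} {S T : Set α}

lemma isNBC_empty (M : Matroid α) (r : α → ℕ) : M.IsNBC r ∅ :=
  ⟨Set.empty_subset _, by simp, fun _ he h =>
    he (M.closure_subset_closure (Set.sep_subset _ _) h)⟩

lemma IsNBC.subset (h : M.IsNBC r S) (hTS : T ⊆ S) : M.IsNBC r T where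
  subset_ground := hTS.trans h.subset_ground
  notMem_closure_empty e he := h.notMem_closure_empty e (hTS he)
  notMem_closure e he hmem := h.notMem_closure e he
    (M.closure_subset_closure (show {x ∈ T | r e < r x} ⊆ {x ∈ S | r e < r x} from
      fun _ hx => ⟨hTS hx.1, hx.2⟩) hmem)

/-- The least element of a circuit inside `S` would be spanned by the later ones. -/
lemma IsNBC.indep [M.Finite] (h : M.IsNBC r S) (hr : Set.InjOn r M.E) : M.Indep S := by
  by_contra hS
  obtain ⟨C, hCS, hC⟩ := ((not_indep_iff h.subset_ground).1 hS).exists_isCircuit_subset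
  have hfin : C.Finite := M.ground_finite.subset hC.subset_ground
  obtain ⟨e, heC, hmin⟩ := Set.exists_min_image C r hfin hC.nonempty
  refine h.notMem_closure e (h.notMem_closure_empty e (hCS heC))
    (M.closure_subset_closure ?_ (hC.mem_closure_sdiff_singleton_of_mem heC))
  rintro x ⟨hxC, hxe⟩
  refine ⟨hCS hxC, lt_of_le_of_ne (hmin x hxC) fun hex => hxe ?_⟩
  exact (hr (hC.subset_ground heC) (hC.subset_ground hxC) hex).symm

/-- Adjoining the least nonloop of a flat keeps a subset of the flat free of broken circuits. -/
lemma IsNBC.insert_of_forall_le {F : Set α} {e : α} (h : M.IsNBC r S) (hF : M.IsFlat F)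
    (hSF : S ⊆ F) (heF : e ∈ F) (he : e ∉ M.closure ∅)
    (hmin : ∀ x ∈ F, x ∉ M.closure ∅ → r e ≤ r x) : M.IsNBC r (insert e S) where
  subset_ground := Set.insert_subset (hF.subset_ground heF) h.subset_ground
  notMem_closure_empty := by
    rintro x (rfl | hx)
    exacts [he, h.notMem_closure_empty x hx]
  notMem_closure x hx hmem := by
    obtain hlt | hle := lt_or_ge (r x) (r e)
    · have hsub : {y ∈ insert e S | r x < r y} ⊆ F :=
        fun y hy => Set.insert_subset heF hSF hy.1
      have hxF : x ∈ F := hF.closure ▸ M.closure_subset_closure hsub hmem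
      exact absurd (hmin x hxF hx) (not_le.2 hlt)
    · refine h.notMem_closure x hx (M.closure_subset_closure ?_ hmem)
      rintro y ⟨rfl | hy, hxy⟩
      exacts [absurd hxy (not_lt.2 hle), ⟨hy, hxy⟩]

lemma finite_setOf_isNBC (M : Matroid α) [M.Finite] (r : α → ℕ) : {S | M.IsNBC r S}.Finite :=
  M.ground_finite.finite_subsets.subset fun _ hS => hS.subset_ground

/-- The finite set of all sets containing no broken circuit. -/
noncomputable def nbc (M : Matroid α) [M.Finite] (r : α → ℕ) : Finset (Set α) :=
  (M.finite_setOf_isNBC r).toFinset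

@[simp] lemma mem_nbc [M.Finite] : S ∈ M.nbc r ↔ M.IsNBC r S := by simp [nbc]

open Classical in
/-- The number of sets of size `i` containing no broken circuit. -/
noncomputable def nbcCard (M : Matroid α) [M.Finite] (r : α → ℕ) (i : ℕ) : ℕ :=
  ((M.nbc r).filter fun S => S.ncard = i).card

lemma nbcCard_zero (M : Matroid α) [M.Finite] (r : α → ℕ) : M.nbcCard r 0 = 1 := by
  classical
  rw [nbcCard, Finset.card_eq_one]
  refine ⟨∅, Finset.eq_singleton_iff_unique_mem.2 ⟨by simp [isNBC_empty], fun S hS => ?_⟩⟩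
  obtain ⟨hS, h0⟩ := Finset.mem_filter.1 hS
  exact (Set.ncard_eq_zero (M.ground_finite.subset (mem_nbc.1 hS).subset_ground)).1 h0

lemma IsNBC.eRk_toNat [M.Finite] (h : M.IsNBC r S) (hr : Set.InjOn r M.E) :
    (M.eRk S).toNat = S.ncard := by
  rw [(h.indep hr).eRk_eq_encard, Set.ncard]

lemma IsNBC.ncard_le [M.Finite] (h : M.IsNBC r S) (hr : Set.InjOn r M.E) :
    S.ncard ≤ M.eRank.toNat := by
  rw [← h.eRk_toNat hr]
  exact ENat.toNat_le_toNat (M.eRk_le_eRank S) (M.eRank_ne_top_iff.2 inferInstance)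

lemma nbcCard_eq_zero [M.Finite] (hr : Set.InjOn r M.E) {i : ℕ} (hi : M.eRank.toNat < i) :
    M.nbcCard r i = 0 := by
  classical
  rw [nbcCard, Finset.card_eq_zero, Finset.filter_eq_empty_iff]
  intro S hS hSi
  have := (mem_nbc.1 hS).ncard_le hr
  omega

-- Toggling the least nonloop of `F` is a sign-reversing involution without fixed points; it exists
-- unless `F` consists of loops.
open Classical in
lemma sum_nbc_subset [M.Finite] (r : α → ℕ) (F : M.Flats) :
    ∑ S ∈ (M.nbc r).filter (fun S => S ⊆ (F : Set α)), (-1 : ℤ) ^ S.ncard =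
      if M.botFlat = F then 1 else 0 := by
  obtain ⟨F, hF⟩ := F
  split_ifs with hbot
  · have hF0 : M.closure ∅ = F := congrArg Subtype.val hbot
    have : (M.nbc r).filter (fun S => S ⊆ F) = {∅} := by
      refine Finset.eq_singleton_iff_unique_mem.2 ⟨by simp [isNBC_empty], fun S hS => ?_⟩
      obtain ⟨hS, hSF⟩ := Finset.mem_filter.1 hS
      refine Set.eq_empty_of_forall_notMem fun x hx => ?_
      exact (mem_nbc.1 hS).notMem_closure_empty x hx (hF0.symm.subset (hSF hx))
    simp [this]
  · have hne : (F \ M.closure ∅).Nonempty := by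
      rw [Set.nonempty_iff_ne_empty, Ne, Set.sdiff_eq_empty]
      intro hsub
      refine hbot (Subtype.ext (Set.Subset.antisymm ?_ hsub))
      exact (M.closure_subset_closure (Set.empty_subset F)).trans hF.closure.subset
    have hfin : (F \ M.closure ∅).Finite :=
      M.ground_finite.subset (Set.sdiff_subset.trans hF.subset_ground)
    obtain ⟨e, ⟨heF, he⟩, hmin⟩ := Set.exists_min_image _ r hfin hne
    have hSfin {S : Set α} (hS : M.IsNBC r S) : S.Finite :=
      M.ground_finite.subset hS.subset_ground
    refine Finset.sum_involution
      (fun S _ => if e ∈ S then S \ {e} else insert e S) ?_ ?_ ?_ ?_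
    · intro S hS
      have hSn := hSfin (mem_nbc.1 (Finset.mem_filter.1 hS).1)
      by_cases heS : e ∈ S
      · rw [if_pos heS, ← Set.ncard_sdiff_singleton_add_one heS hSn]
        ring
      · rw [if_neg heS, Set.ncard_insert_of_notMem heS hSn]
        ring
    · intro S _ _
      by_cases heS : e ∈ S
      · rw [if_pos heS]
        exact fun h => (h.symm.subset heS).2 rfl
      · rw [if_neg heS]
        exact fun h => heS (h ▸ Set.mem_insert e S)
    · intro S hS
      obtain ⟨hS, hSF⟩ := Finset.mem_filter.1 hS
      rw [mem_nbc] at hS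
      rw [Finset.mem_filter, mem_nbc]
      by_cases heS : e ∈ S
      · rw [if_pos heS]
        exact ⟨hS.subset Set.sdiff_subset, Set.sdiff_subset.trans hSF⟩
      · rw [if_neg heS]
        exact ⟨hS.insert_of_forall_le hF hSF heF he fun x hx hx' => hmin x ⟨hx, hx'⟩,
          Set.insert_subset heF hSF⟩
    · intro S _
      by_cases heS : e ∈ S <;> simp [heS]

open Classical in
/-- Whitney's broken circuit theorem for the Möbius function of the lattice of flats. -/
lemma moebius_eq_sum_nbc [M.Finite] (r : α → ℕ) (F : M.Flats) :
    M.moebius F = ∑ S ∈ (M.nbc r).filter (fun S => M.closure S = F), (-1 : ℤ) ^ S.ncard := by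
  have hbot (G : M.Flats) : M.botFlat ≤ G :=
    show M.closure ∅ ⊆ G from G.2.closure ▸ M.closure_subset_closure (Set.empty_subset _)
  -- Both sides satisfy the recursion defining `μ`: grouping the sets inside `F` by their closure
  -- reduces this to `sum_nbc_subset`.
  have hsum (F : M.Flats) : ∑ G ∈ Finset.Icc M.botFlat F, M.moebius G =
      ∑ G ∈ Finset.Icc M.botFlat F,
        ∑ S ∈ (M.nbc r).filter (fun S => M.closure S = G), (-1 : ℤ) ^ S.ncard := by
    have h₁ : ∑ G ∈ Finset.Icc M.botFlat F, M.moebius G = if M.botFlat = F then 1 else 0 :=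
      IncidenceAlgebra.sum_Icc_mu_right (𝕜 := ℤ) M.botFlat F
    rw [h₁, ← sum_nbc_subset r F, ← Finset.sum_fiberwise_of_maps_to
      (t := Finset.Icc M.botFlat F) (g := fun S => (⟨M.closure S, isFlat_closure S⟩ : M.Flats))]
    · refine Finset.sum_congr rfl fun G hG => Finset.sum_congr ?_ fun _ _ => rfl
      ext S
      simp only [Finset.mem_filter, Subtype.ext_iff]
      refine ⟨fun h => ⟨h.1.1, h.2⟩, fun h => ⟨⟨h.1, ?_⟩, h.2⟩⟩
      have hGF : (G : Set α) ⊆ F := (Finset.mem_Icc.1 hG).2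
      exact (M.subset_closure S (mem_nbc.1 h.1).subset_ground).trans (h.2.subset.trans hGF)
    · intro S hS
      refine Finset.mem_Icc.2 ⟨hbot _, ?_⟩
      exact (M.closure_subset_closure (Finset.mem_filter.1 hS).2).trans F.2.closure.subset
  induction F using WellFoundedLT.induction with
  | ind F ih =>
    have h := hsum F
    rw [← Finset.Ico_insert_right (hbot F), Finset.sum_insert Finset.right_notMem_Ico,
      Finset.sum_insert Finset.right_notMem_Ico,
      Finset.sum_congr rfl fun G hG => ih G (Finset.mem_Ico.1 hG).2] at h
    exact add_right_cancel h

/-- Whitney's broken circuit theorem: the coefficients of the characteristic polynomial count the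
sets containing no broken circuit. -/
theorem charPoly_eq_sum_nbcCard [M.Finite] (hr : Set.InjOn r M.E) :
    M.charPoly = ∑ i ∈ Finset.range (M.eRank.toNat + 1),
      C ((-1) ^ i * (M.nbcCard r i : ℤ)) * X ^ (M.eRank.toNat - i) := by
  classical
  have h₁ : M.charPoly =
      ∑ S ∈ M.nbc r, C ((-1 : ℤ) ^ S.ncard) * X ^ (M.eRank.toNat - S.ncard) := by
    rw [charPoly, ← Finset.sum_fiberwise (M.nbc r)
      (fun S => (⟨M.closure S, isFlat_closure S⟩ : M.Flats))]
    refine Finset.sum_congr rfl fun F _ => ?_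
    rw [moebius_eq_sum_nbc r F, map_sum, Finset.sum_mul]
    simp only [Subtype.ext_iff]
    refine Finset.sum_congr rfl fun S hS => ?_
    obtain ⟨hS, hSF⟩ := Finset.mem_filter.1 hS
    rw [← hSF, eRk_closure_eq, (mem_nbc.1 hS).eRk_toNat hr]
  rw [h₁, ← Finset.sum_fiberwise_of_maps_to (t := Finset.range (M.eRank.toNat + 1))
    (g := Set.ncard)]
  · refine Finset.sum_congr rfl fun i _ => ?_
    rw [Finset.sum_congr rfl fun S hS => by rw [(Finset.mem_filter.1 hS).2], Finset.sum_const,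
      ← nbcCard]
    simp only [map_mul, map_natCast, nsmul_eq_mul]
    ring
  · intro S hS
    exact Finset.mem_range.2 (Nat.lt_succ_of_le ((mem_nbc.1 hS).ncard_le hr))

end NBC

/-! ### Uniqueness of the signed coefficients -/

section Coefficients

lemma coeff_sum_C_mul_X_pow_sub (m k : ℕ) (a : ℕ → ℤ) :
    (∑ i ∈ Finset.range (m + 1), C ((-1) ^ i * a i) * X ^ (m - i) : ℤ[X]).coeff k =
      if k ≤ m then (-1) ^ (m - k) * a (m - k) else 0 := by
  simp only [finsetSum_coeff, coeff_C_mul_X_pow]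
  split_ifs with hk
  · rw [Finset.sum_eq_single (m - k)]
    · rw [if_pos (by omega)]
    · intro i hi hne
      rw [Finset.mem_range] at hi
      exact if_neg (by omega)
    · intro h
      exact absurd (Finset.mem_range.2 (by omega)) h
  · exact Finset.sum_eq_zero fun i _ => if_neg (by omega)

/-- A monic polynomial determines its signed coefficient sequence, counted from the top. -/
lemma signed_coeffs_unique {m n : ℕ} {a b : ℕ → ℤ} (ha_zero : a 0 = 1) (hb_zero : b 0 = 1)
    (ha : ∀ i, m < i → a i = 0) (hb : ∀ i, n < i → b i = 0)
    (h : (∑ i ∈ Finset.range (m + 1), C ((-1) ^ i * a i) * X ^ (m - i) : ℤ[X]) =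
      ∑ i ∈ Finset.range (n + 1), C ((-1) ^ i * b i) * X ^ (n - i)) (i : ℕ) : a i = b i := by
  have hcoeff (k : ℕ) := congrArg (fun p => coeff p k) h
  simp only [coeff_sum_C_mul_X_pow_sub] at hcoeff
  -- The leading coefficients are 1, so comparing them forces the two degrees to agree.
  have hmn : m ≤ n := by
    by_contra hlt
    simpa [hlt, ha_zero] using hcoeff m
  have hnm : n ≤ m := by
    by_contra hlt
    simpa [hlt, hb_zero] using hcoeff n
  obtain rfl := le_antisymm hmn hnm
  obtain hi | hi := le_or_gt i m
  · simpa [Nat.sub_sub_self hi] using hcoeff (m - i)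
  · rw [ha i hi, hb i hi]

end Coefficients

/-! ### Transfer along a weak map -/

section WeakMap

variable {α β : Type*} {M : Matroid α} {N : Matroid β}

/-- A section of a weak map carries sets without broken circuits to sets without broken circuits,
provided that it preserves the order and its values precede all other elements. -/
lemma IsNBC.image_of_isWeakMap [N.Finite] {φ : α → Option β} (hφ : M.IsWeakMap N φ) {s : β → α}
    (hsE : ∀ y ∈ N.E, s y ∈ M.E) (hs : ∀ y ∈ N.E, φ (s y) = some y) {r : β → ℕ} {q : α → ℕ}
    (hr : Set.InjOn r N.E) (hq : ∀ y ∈ N.E, y ∉ N.closure ∅ → q (s y) = r y)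
    (hlt : ∀ x ∈ M.E, x ∉ s '' (N.E \ N.closure ∅) →
      ∀ y ∈ N.E, y ∉ N.closure ∅ → q (s y) < q x) {S : Set β}
    (h : N.IsNBC r S) : M.IsNBC q (s '' S) := by
  have hindep (I : Set β) (hI : N.Indep I) : M.Indep (s '' I) := by
    refine hφ.indep_of_indep _ ?_ I hI ⟨?_, ?_, ?_⟩
    · rintro _ ⟨y, hy, rfl⟩
      exact hsE y (hI.subset_ground hy)
    · rintro _ ⟨y, hy, rfl⟩
      exact ⟨y, hy, (hs y (hI.subset_ground hy)).symm⟩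
    · rintro _ ⟨y, hy, rfl⟩ _ ⟨z, hz, rfl⟩ hyz
      rw [hs y (hI.subset_ground hy), hs z (hI.subset_ground hz), Option.some_inj] at hyz
      rw [hyz]
    · rintro _ ⟨y, hy, rfl⟩
      exact ⟨s y, ⟨y, hy, rfl⟩, hs y (hI.subset_ground hy)⟩
  have hSE := h.subset_ground
  have hS := h.indep hr
  refine ⟨(hindep S hS).subset_ground, ?_, fun e he hmem => ?_⟩
  · intro x hx hx0
    exact (hindep S hS).isNonloop_of_mem hx |>.not_isLoop hx0
  have heE : e ∈ M.E := mem_ground_of_mem_closure hmem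
  by_cases hes : e ∈ s '' (N.E \ N.closure ∅)
  · obtain ⟨y, ⟨hy, hy0⟩, rfl⟩ := hes
    have hset : {x ∈ s '' S | q (s y) < q x} = s '' {z ∈ S | r y < r z} := by
      ext x
      constructor
      · rintro ⟨⟨z, hz, rfl⟩, hlt⟩
        rw [hq y hy hy0, hq z (hSE hz) (h.notMem_closure_empty z hz)] at hlt
        exact ⟨z, ⟨hz, hlt⟩, rfl⟩
      · rintro ⟨z, ⟨hz, hlt⟩, rfl⟩
        refine ⟨⟨z, hz, rfl⟩, ?_⟩
        rwa [hq y hy hy0, hq z (hSE hz) (h.notMem_closure_empty z hz)]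
    rw [hset] at hmem
    have hTS : {z ∈ S | r y < r z} ⊆ S := fun z hz => hz.1
    -- Dependence descends to `N`: otherwise adjoining `y` gives an independent set of `N`, whose
    -- lift is independent in `M`, against `hmem`.
    have hyN : y ∈ N.closure {z ∈ S | r y < r z} := by
      by_contra hyN
      have hins := (hS.subset hTS).insert_indep_iff.2 (.inl ⟨hy, hyN⟩)
      have hM := hindep _ hins
      rw [Set.image_insert_eq] at hM
      have hnot : s y ∉ s '' {z ∈ S | r y < r z} := by
        rintro ⟨z, ⟨hz, hlt⟩, hzy⟩
        have := hs z (hSE hz)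
        rw [hzy, hs y hy, Option.some_inj] at this
        exact absurd hlt (this ▸ lt_irrefl _)
      exact ((hindep _ (hS.subset hTS)).insert_indep_iff_of_notMem hnot |>.1 hM).2 hmem
    exact h.notMem_closure y hy0 hyN
  -- Here `e` comes after all of `s '' S`, so it would lie in the closure of `∅`.
  · refine he (M.closure_subset_closure ?_ hmem)
    rintro x ⟨⟨z, hz, rfl⟩, hxe⟩
    exact absurd hxe (hlt e heE hes z (hSE hz) (h.notMem_closure_empty z hz)).not_gt

lemma exists_injOn_ground (M : Matroid α) [M.Finite] : ∃ r : α → ℕ, Set.InjOn r M.E :=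
  (Set.countable_iff_exists_injOn).1 M.ground_finite.countable

/-- Suitable orders can be chosen on the two ground sets so that the target of a weak map has at
most as many sets without broken circuits, in each size, as the source. -/
lemma IsWeakMapImage.exists_nbcCard_le [M.Finite] [N.Finite] (h : N.IsWeakMapImage M) :
    ∃ (q : α → ℕ) (r : β → ℕ), Set.InjOn q M.E ∧ Set.InjOn r N.E ∧
      ∀ i, N.nbcCard r i ≤ M.nbcCard q i := by
  classical
  obtain ⟨φ, hφ, hsurj⟩ := h
  obtain ⟨p, hp⟩ := M.exists_injOn_ground
  obtain ⟨r, hr⟩ := N.exists_injOn_ground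
  -- Choosing a section as a total function needs `α` nonempty, so an empty `N` is treated apart.
  obtain hE | ⟨y₀, hy₀⟩ := N.E.eq_empty_or_nonempty
  · refine ⟨p, r, hp, hr, fun i => ?_⟩
    obtain rfl | hi := Nat.eq_zero_or_pos i
    · rw [nbcCard_zero, nbcCard_zero]
    · have hrank : N.eRank.toNat = 0 := by simp [← eRk_ground, hE]
      rw [nbcCard_eq_zero hr (hrank ▸ hi)]
      exact Nat.zero_le _
  have : Nonempty α := ⟨(hsurj y₀ hy₀).choose⟩
  choose! s hsE hs using hsurj
  obtain ⟨K, hK⟩ := (N.ground_finite.image r).bddAbove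
  have hrK {y : β} (hy : y ∈ N.E) : r y ≤ K := hK ⟨y, hy, rfl⟩
  -- The shift by `K + 1` puts everything else after the lifted nonloops. Lifts of loops of `N` go
  -- there too, since they may be nonloops of `M`. The default `0` is never reached, as `φ (s y) =
  -- some y`.
  let q : α → ℕ := fun x =>
    if x ∈ s '' (N.E \ N.closure ∅) then (φ x).elim 0 r else K + 1 + p x
  have hq (y : β) (hy : y ∈ N.E) (hy0 : y ∉ N.closure ∅) : q (s y) = r y := by
    simp only [q, if_pos (Set.mem_image_of_mem s (show y ∈ N.E \ N.closure ∅ from ⟨hy, hy0⟩)),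
      hs y hy, Option.elim_some]
  have hq' {x : α} (hx : x ∉ s '' (N.E \ N.closure ∅)) : q x = K + 1 + p x := if_neg hx
  have hlt (x : α) (_ : x ∈ M.E) (hx : x ∉ s '' (N.E \ N.closure ∅)) (y : β) (hy : y ∈ N.E)
      (hy0 : y ∉ N.closure ∅) : q (s y) < q x := by
    rw [hq y hy hy0, hq' hx]
    have := hrK hy
    omega
  have hq_inj : Set.InjOn q M.E := by
    intro x hx x' hx' hxx
    by_cases h₁ : x ∈ s '' (N.E \ N.closure ∅) <;> by_cases h₂ : x' ∈ s '' (N.E \ N.closure ∅)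
    · obtain ⟨y, ⟨hy, hy0⟩, rfl⟩ := h₁
      obtain ⟨z, ⟨hz, hz0⟩, rfl⟩ := h₂
      rw [hq y hy hy0, hq z hz hz0] at hxx
      rw [hr hy hz hxx]
    · obtain ⟨y, ⟨hy, hy0⟩, rfl⟩ := h₁
      exact absurd hxx (hlt x' hx' h₂ y hy hy0).ne
    · obtain ⟨y, ⟨hy, hy0⟩, rfl⟩ := h₂
      exact absurd hxx (hlt x hx h₁ y hy hy0).ne'
    · rw [hq' h₁, hq' h₂] at hxx
      exact hp hx hx' (by omega)
  have hs_inj : Set.InjOn s N.E := fun y hy z hz hyz => by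
    rw [← Option.some_inj, ← hs y hy, ← hs z hz, hyz]
  refine ⟨q, r, hq_inj, hr, fun i => ?_⟩
  refine Finset.card_le_card_of_injOn (s '' ·) (fun S hS => ?_) fun S hS T hT hST => ?_
  · obtain ⟨hS, hSi⟩ := Finset.mem_filter.1 hS
    rw [mem_nbc] at hS
    refine Finset.mem_coe.2 (Finset.mem_filter.2 ⟨mem_nbc.2 ?_, ?_⟩)
    · exact hS.image_of_isWeakMap hφ hsE hs hr hq hlt
    · rw [(hs_inj.mono hS.subset_ground).ncard_image, hSi]
  · exact (hs_inj.image_eq_image_iff (mem_nbc.1 (Finset.mem_filter.1 hS).1).subset_ground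
      (mem_nbc.1 (Finset.mem_filter.1 hT).1).subset_ground).1 hST

/-- The coefficients of the characteristic polynomial, up to sign and counted from the top, are the
numbers of sets containing no broken circuit. -/
lemma coeff_eq_nbcCard [M.Finite] {r : α → ℕ} (hr : Set.InjOn r M.E) {m : ℕ} {a : ℕ → ℤ}
    (ha_zero : a 0 = 1) (ha_gt : ∀ i, m < i → a i = 0)
    (ha : M.charPoly = ∑ i ∈ Finset.range (m + 1), C ((-1) ^ i * a i) * X ^ (m - i)) (i : ℕ) :
    a i = M.nbcCard r i :=
  signed_coeffs_unique (b := fun i => (M.nbcCard r i : ℤ)) ha_zero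
    (by rw [nbcCard_zero, Nat.cast_one]) ha_gt
    (fun i hi => by rw [nbcCard_eq_zero hr hi, Nat.cast_zero])
    (ha.symm.trans (charPoly_eq_sum_nbcCard hr)) i

end WeakMap

end Matroid

theorem mainTheorem7 {α β : Type*} (M : Matroid α) (N : Matroid β) [M.Finite] [N.Finite]
    (hMN : N.IsWeakMapImage M) (m n : ℕ) (a b : ℕ → ℤ)
    (ha_zero : a 0 = 1) (ha_gt : ∀ i, m < i → a i = 0)
    (ha : M.charPoly = ∑ i ∈ Finset.range (m + 1),
      Polynomial.C ((-1) ^ i * a i) * Polynomial.X ^ (m - i))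
    (hb_zero : b 0 = 1) (hb_gt : ∀ i, n < i → b i = 0)
    (hb : N.charPoly = ∑ i ∈ Finset.range (n + 1),
      Polynomial.C ((-1) ^ i * b i) * Polynomial.X ^ (n - i)) :
    ∀ i, b i ≤ a i := by
  obtain ⟨q, r, hq, hr, hle⟩ := hMN.exists_nbcCard_le
  intro i
  rw [Matroid.coeff_eq_nbcCard hq ha_zero ha_gt ha, Matroid.coeff_eq_nbcCard hr hb_zero hb_gt hb]
  exact_mod_cast hle i
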